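/- For each $n$ let $W=(W_{ij})_{n\times n}$ be a random symmetric matrix with zero diagonal whose entries $(W_{ij})_{1\le i<j\le n}$ are independent standard normal random variables, and for $\sigma\in\{-1,+1\}^n$ put $H(\sigma)=\sum_{1\le i<j\le n}\sigma_i\sigma_jW_{ij}$. Call $\sigma$ locally optimal (a local minimum of $H$) if $H(\sigma^{(i)})\ge H(\sigma)$ for every $i\in\{1,\dots,n\}$, where $\sigma^{(i)}$ is $\sigma$ with its $i$-th coordinate multiplied by $-1$. Let $\Phi$ be the standard normal distribution function, $\phi(\lambda)=\log(2\Phi(\lambda))$, and for $x\ge\sqrt{2/\pi}$ let \[\mu^*(x)=\sup_{\lambda\ge 0}\Bigl(\lambda x-\frac{\lambda^2}{2}-\phi(\lambda)\Bigr),\qquad R(x)=\frac{x^2}{4}-\mu^*(x).\] Then $\mu^*(x)$ is finite for every $x\ge\sqrt{2/\pi}$, and $R$ attains its maximum over $[\sqrt{2/\pi},\infty)$ at a unique point $v^*$, which satisfies $v^*>\sqrt{2/\pi}$; its maximum value $\alpha^*=R(v^*)$ is positive. Moreover: (i) For every choice of $\sigma=\sigma(n)\in\{-1,+1\}^n$,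 $n\ge1$, \[\lim_{n\to\infty}\frac1n\log\mathbb P\{\sigma\text{ is locally optimal}\}=\alpha^*-\log 2.\] (ii) There exist constants $\epsilon_0>0$, $L>0$ and $n_0$ such that for all $0<\epsilon<\epsilon_0$, all $n\ge n_0$ and all $\sigma\in\{-1,+1\}^n$, \[\mathbb P\Bigl\{-\frac{v^*}{2}-\epsilon\le n^{-3/2}H(\sigma)\le-\frac{v^*}{2}+\epsilon\Bigm|\sigma\text{ is locally optimal}\Bigr\}\ge1-\exp\bigl(L\sqrt n-\epsilon^2n\bigr).\] -/

import Mathlib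

open MeasureTheory ProbabilityTheory Filter Topology

namespace SK

/-- `W` is the random coupling matrix of the Sherrington-Kirkpatrick model: symmetric, with zero
diagonal, and with independent standard normal entries above the diagonal. -/
structure IsDisorder {Ω : Type*} [MeasurableSpace Ω] (P : Measure Ω) {n : ℕ}
    (W : Ω → Matrix (Fin n) (Fin n) ℝ) : Prop where
  measurable : ∀ i j, Measurable fun ω => W ω i j
  symm : ∀ ω, (W ω).IsSymm
  diag : ∀ ω i, W ω i i = 0
  law : ∀ i j, i < j → P.map (fun ω => W ω i j) = gaussianReal 0 1
  indep : iIndepFun (fun (p : {p : Fin n × Fin n // p.1 < p.2}) ω => W ω p.1.1 p.1.2) P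

/-- Spin configurations: elements of `{-1, +1}^n` (the group `ℤˣ` is `{1, -1}`). -/
abbrev Config (n : ℕ) : Type := Fin n → ℤˣ

/-- The value of a spin as a real number, `-1` or `1`. -/
def spin (s : ℤˣ) : ℝ := ((s : ℤ) : ℝ)

/-- The Hamiltonian `H(σ) = ∑_{i < j} σ_i σ_j W_{ij}`. -/
def hamiltonian {n : ℕ} (W : Matrix (Fin n) (Fin n) ℝ) (σ : Config n) : ℝ :=
  ∑ i, ∑ j ∈ Finset.Ioi i, spin (σ i) * spin (σ j) * W i j

/-- The configuration obtained from `σ` by flipping the `i`-th spin. -/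
def flip {n : ℕ} (σ : Config n) (i : Fin n) : Config n := Function.update σ i (-σ i)

/-- `σ` is a local minimum of the Hamiltonian: no single flip decreases the energy. -/
def IsLocalMinimum {n : ℕ} (W : Matrix (Fin n) (Fin n) ℝ) (σ : Config n) : Prop :=
  ∀ i, hamiltonian W σ ≤ hamiltonian W (flip σ i)

/-- `φ(l) = log (2 Φ(l))`, with `Φ` the standard normal distribution function. -/
noncomputable def phi (l : ℝ) : ℝ := Real.log (2 * cdf (gaussianReal 0 1) l)

/-- The values `l x - l^2 / 2 - φ(l)`, for `l ≥ 0`. -/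
def legendreValues (x : ℝ) : Set ℝ := (fun l : ℝ => l * x - l ^ 2 / 2 - phi l) '' Set.Ici 0

/-- The rate function `μ*(x) = sup_{l ≥ 0} (l x - l^2 / 2 - φ(l))`. -/
noncomputable def muStar (x : ℝ) : ℝ := sSup (legendreValues x)

/-- `R(x) = x^2 / 4 - μ*(x)`. -/
noncomputable def R (x : ℝ) : ℝ := x ^ 2 / 4 - muStar x

end SK

namespace SK

/-! For a fixed `σ`, flipping spin `i` changes the energy by twice the local field `X i`. So local
optimality means that all `X i` are nonnegative, and `H = -(1/2) ∑ X i`. The fields form an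
exchangeable Gaussian vector with variances `n - 1` and covariances `1`, hence are distributed as
`√(n-2) N i + N₀` (`IsDisorder.map_localField`). Given `N₀ = z` they are independent, so every
expectation needed is a one-dimensional integral of an `n`-th power.

Everything is governed by a number `c > 0` at which `log Φ(u) - u²/2` is critical. Log-concavity
gives `Φ(u) ≤ Φ(c) exp(c(u-c))`; inserted in the integral, this yields a Gaussian integral and an
upper bound `exp(nκ + O(1))` with `κ = log Φ(c) - c²/2`. Keeping only `z` near `c√(n-2)` gives the
matching lower bound up to `exp(-O(√n))`. An exponential tilt of the sum in the same computation
gives tails smaller by `exp(-s²n)`, which is the concentration.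

On the variational side, testing `μ*(x)` at `l = x/2` gives `R(x) ≤ φ(x/2) - (x/2)²/2`, whose right
side has its unique maximum at `x = 2c`. Equality holds there by log-convexity of `exp(l²/2) Φ(l)`.
Thus `v* = 2c` and `α* - log 2 = κ`. -/

/-! ### The standard normal distribution function -/

theorem gaussianPDFReal_zero_one (x : ℝ) :
    gaussianPDFReal 0 1 x = (√(2 * Real.pi))⁻¹ * Real.exp (-x ^ 2 / 2) := by
  simp [gaussianPDFReal]

theorem hasDerivAt_cdf_gaussianReal (x : ℝ) :
    HasDerivAt (cdf (gaussianReal 0 1)) (gaussianPDFReal 0 1 x) x := by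
  have hc : Continuous (gaussianPDFReal 0 1) := by
    simp_rw [funext gaussianPDFReal_zero_one]; fun_prop
  have hI : ∀ a, cdf (gaussianReal 0 1) a = ∫ y in Set.Iic a, gaussianPDFReal 0 1 y := fun a => by
    rw [cdf_eq_real, measureReal_def, gaussianReal_apply_eq_integral _ one_ne_zero,
      ENNReal.toReal_ofReal]
    exact integral_nonneg fun y => gaussianPDFReal_nonneg _ _ _
  have h : (cdf (gaussianReal 0 1) : ℝ → ℝ) =
      fun a => cdf (gaussianReal 0 1) 0 + ∫ y in (0 : ℝ)..a, gaussianPDFReal 0 1 y := by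
    ext a
    rw [hI, hI, ← intervalIntegral.integral_Iic_sub_Iic]
    · ring
    · exact (integrable_gaussianPDFReal 0 1).integrableOn
    · exact (integrable_gaussianPDFReal 0 1).integrableOn
  rw [h]
  exact (intervalIntegral.integral_hasDerivAt_right (hc.intervalIntegrable _ _)
    (hc.stronglyMeasurableAtFilter _ _) hc.continuousAt).const_add _

theorem continuous_cdf_gaussianReal : Continuous (cdf (gaussianReal 0 1)) :=
  continuous_iff_continuousAt.2 fun x => (hasDerivAt_cdf_gaussianReal x).continuousAt

theorem gaussianReal_Ici_eq_Iic_neg (a : ℝ) :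
    gaussianReal 0 1 (Set.Ici a) = gaussianReal 0 1 (Set.Iic (-a)) := by
  conv_lhs => rw [← neg_zero, ← gaussianReal_map_neg]
  rw [Measure.map_apply measurable_neg measurableSet_Ici]
  congr 1
  ext x
  simp

theorem cdf_gaussianReal_zero : cdf (gaussianReal 0 1) 0 = 1 / 2 := by
  have h1 : (gaussianReal 0 1).real (Set.Ici 0) = cdf (gaussianReal 0 1) 0 := by
    rw [cdf_eq_real, measureReal_def, gaussianReal_Ici_eq_Iic_neg, neg_zero, measureReal_def]
  have h2 := probReal_compl_eq_one_sub (μ := gaussianReal 0 1) (measurableSet_Ici (a := (0 : ℝ)))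
  have := nullSingletonClass_gaussianReal (μ := 0) (v := 1) one_ne_zero
  rw [Set.compl_Ici, measureReal_congr Iio_ae_eq_Iic, ← cdf_eq_real, h1] at h2
  linarith

theorem cdf_gaussianReal_pos (x : ℝ) : 0 < cdf (gaussianReal 0 1) x := by
  have hm : StrictMono (cdf (gaussianReal 0 1)) :=
    strictMono_of_hasDerivAt_pos hasDerivAt_cdf_gaussianReal
      fun x => gaussianPDFReal_pos _ _ _ one_ne_zero
  exact (cdf_nonneg _ _).trans_lt (hm (sub_one_lt x))

theorem phi_nonneg {l : ℝ} (hl : 0 ≤ l) : 0 ≤ phi l := by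
  have := monotone_cdf (gaussianReal 0 1) hl
  rw [cdf_gaussianReal_zero] at this
  exact Real.log_nonneg (by linarith)

theorem phi_zero : phi 0 = 0 := by
  simp [phi, cdf_gaussianReal_zero]

theorem bddAbove_legendreValues (x : ℝ) : BddAbove (legendreValues x) := by
  refine ⟨x ^ 2 / 2, ?_⟩
  rintro _ ⟨l, hl, rfl⟩
  have := phi_nonneg hl
  simp only
  nlinarith [sq_nonneg (l - x)]

/-! ### The critical point and its two tangent bounds -/

/-- The critical point of `phi l - l ^ 2 / 2`. -/
theorem exists_critical_point : ∃ c : ℝ, (√(2 * Real.pi))⁻¹ < c ∧ c < 1 ∧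
    c * cdf (gaussianReal 0 1) c = gaussianPDFReal 0 1 c := by
  -- This endpoint is half of `√(2/π)`, so a root beyond it gives `2c > √(2/π)`. It is also the
  -- maximum of the density.
  set a : ℝ := (√(2 * Real.pi))⁻¹ with ha
  have hpi := Real.pi_gt_three
  have ha0 : 0 < a := by positivity
  have ha2 : a ^ 2 = (2 * Real.pi)⁻¹ := by
    rw [ha, inv_pow, Real.sq_sqrt (by positivity)]
  have ha6 : a ^ 2 < 1 / 6 := by
    rw [ha2, inv_eq_one_div]; exact one_div_lt_one_div_of_lt (by norm_num) (by linarith)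
  have ha1 : a < 1 / 2 := by nlinarith
  have hle : ∀ x, gaussianPDFReal 0 1 x ≤ a := fun x => by
    rw [gaussianPDFReal_zero_one]
    exact mul_le_of_le_one_right ha0.le (Real.exp_le_one_iff.2 (by nlinarith [sq_nonneg x]))
  have hcont : Continuous fun x => x * cdf (gaussianReal 0 1) x - gaussianPDFReal 0 1 x := by
    simp_rw [gaussianPDFReal_zero_one]
    have := continuous_cdf_gaussianReal
    fun_prop
  have hcdf : cdf (gaussianReal 0 1) a ≤ 1 / 2 + a ^ 2 := by
    have := Convex.image_sub_le_mul_sub_of_deriv_le (convex_univ (𝕜 := ℝ) (E := ℝ))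
      (f := cdf (gaussianReal 0 1)) continuous_cdf_gaussianReal.continuousOn
      (fun x _ => (hasDerivAt_cdf_gaussianReal x).differentiableAt.differentiableWithinAt)
      (C := a) (fun x _ => by rw [(hasDerivAt_cdf_gaussianReal x).deriv]; exact hle x)
      0 trivial a trivial ha0.le
    rw [cdf_gaussianReal_zero] at this
    linarith
  have hexp : 1 - a ^ 2 / 2 ≤ Real.exp (-a ^ 2 / 2) := by
    linarith [Real.add_one_le_exp (-a ^ 2 / 2)]
  -- After division by `a` it suffices that `1/2 + a² < 1 - a²/2`, which follows from `a² < 1/6`.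
  have hneg : a * cdf (gaussianReal 0 1) a - gaussianPDFReal 0 1 a < 0 := by
    rw [gaussianPDFReal_zero_one, ← ha, ← mul_sub]
    exact mul_neg_of_pos_of_neg ha0 (by linarith)
  have hpos : 0 < 1 * cdf (gaussianReal 0 1) 1 - gaussianPDFReal 0 1 1 := by
    have := monotone_cdf (gaussianReal 0 1) zero_le_one
    rw [cdf_gaussianReal_zero] at this
    linarith [hle 1]
  obtain ⟨c, hc, h0⟩ := intermediate_value_Ioo (by linarith : a ≤ 1) hcont.continuousOn
    (Set.mem_Ioo.2 ⟨hneg, hpos⟩)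
  exact ⟨c, hc.1, hc.2, by simpa [sub_eq_zero] using h0⟩

/-- Log-concavity of the normal distribution function, as a tangent bound at the critical point. -/
theorem cdf_le_tangent {c : ℝ} (hc : 0 < c)
    (h : c * cdf (gaussianReal 0 1) c = gaussianPDFReal 0 1 c) (u : ℝ) :
    cdf (gaussianReal 0 1) u ≤ cdf (gaussianReal 0 1) c * Real.exp (c * (u - c)) := by
  set Q : ℝ → ℝ := fun u => cdf (gaussianReal 0 1) c * Real.exp (c * (u - c)) -
    cdf (gaussianReal 0 1) u with hQ
  set k : ℝ := (√(2 * Real.pi))⁻¹ with hk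
  have hk0 : 0 < k := by positivity
  -- The critical equation replaces `c Φ(c)` by the density at `c`, so the derivative is a
  -- difference of two exponentials whose sign is that of `(u - c)(u + 3c)`. Hence `Q` rises from
  -- its limit `0` at `-∞` up to `-3c`, falls to `Q c = 0`, then rises again.
  have hd : ∀ u, HasDerivAt Q (k * Real.exp (-c ^ 2 / 2 + c * (u - c)) -
      k * Real.exp (-u ^ 2 / 2)) u := fun u => by
    have h1 := ((((hasDerivAt_id u).sub_const c).const_mul c).exp.const_mul
      (cdf (gaussianReal 0 1) c)).sub (hasDerivAt_cdf_gaussianReal u)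
    rw [gaussianPDFReal_zero_one] at h1 h
    refine h1.congr_deriv ?_
    rw [Real.exp_add, id]
    linear_combination Real.exp (c * (u - c)) * h
  have hQc : Continuous Q := continuous_iff_continuousAt.2 fun x => (hd x).continuousAt
  have hsign : ∀ u, -c ^ 2 / 2 + c * (u - c) - -u ^ 2 / 2 = (u - c) * (u + 3 * c) / 2 := fun u => by
    ring
  have hnn : ∀ u, 0 ≤ (u - c) * (u + 3 * c) → 0 ≤ deriv Q u := fun u hu => by
    rw [(hd u).deriv, ← mul_sub]
    refine mul_nonneg hk0.le (sub_nonneg.2 (Real.exp_le_exp.2 ?_))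
    linarith [hsign u]
  have hnp : ∀ u, (u - c) * (u + 3 * c) ≤ 0 → deriv Q u ≤ 0 := fun u hu => by
    rw [(hd u).deriv, ← mul_sub]
    refine mul_nonpos_of_nonneg_of_nonpos hk0.le (sub_nonpos.2 (Real.exp_le_exp.2 ?_))
    linarith [hsign u]
  have hdiff : Differentiable ℝ Q := fun u => (hd u).differentiableAt
  have hQcc : Q c = 0 := by simp [hQ]
  suffices 0 ≤ Q u from sub_nonneg.1 this
  rcases le_total c u with hu | hu
  · have := monotoneOn_of_deriv_nonneg (convex_Ici c) hQc.continuousOn hdiff.differentiableOn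
      (fun x hx => hnn x (by rw [interior_Ici] at hx; have : c < x := hx; apply mul_nonneg <;> linarith))
    simpa [hQcc] using this Set.self_mem_Ici hu hu
  rcases le_total (-(3 * c)) u with hu' | hu'
  · have := antitoneOn_of_deriv_nonpos (convex_Icc (-(3 * c)) c) hQc.continuousOn
      hdiff.differentiableOn (fun x hx => hnp x (by
        rw [interior_Icc] at hx
        exact mul_nonpos_of_nonpos_of_nonneg (by linarith [hx.2]) (by linarith [hx.1])))
    simpa [hQcc] using this ⟨hu', hu⟩ ⟨by linarith, le_rfl⟩ hu
  · have hm := monotoneOn_of_deriv_nonneg (convex_Iic (-(3 * c))) hQc.continuousOn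
      hdiff.differentiableOn (fun x hx => hnn x (by
        rw [interior_Iic] at hx; have : x < -(3 * c) := hx
        apply mul_nonneg_of_nonpos_of_nonpos <;> linarith))
    have hlim : Tendsto Q atBot (𝓝 0) := by
      have h1 : Tendsto (fun u : ℝ => c * (u - c)) atBot atBot :=
        (tendsto_atBot_add_const_right _ (-c) tendsto_id).const_mul_atBot hc
      have h2 := ((Real.tendsto_exp_atBot.comp h1).const_mul (cdf (gaussianReal 0 1) c)).sub
        (tendsto_cdf_atBot (gaussianReal 0 1))
      simpa using h2
    refine le_of_tendsto hlim ?_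
    filter_upwards [eventually_le_atBot u] with x hx
    exact hm (hx.trans hu') hu' hx

/-- Partial exponential moments of the standard normal distribution. -/
theorem setLIntegral_exp_Ici_gaussianReal (a b : ℝ) :
    ∫⁻ x in Set.Ici a, ENNReal.ofReal (Real.exp (b * x)) ∂(gaussianReal 0 1) =
      ENNReal.ofReal (Real.exp (b ^ 2 / 2) * cdf (gaussianReal 0 1) (b - a)) := by
  rw [ENNReal.ofReal_mul (Real.exp_nonneg _), ofReal_cdf, ← neg_sub, ← gaussianReal_Ici_eq_Iic_neg,
    ← lintegral_indicator measurableSet_Ici, gaussianReal_of_var_ne_zero _ one_ne_zero,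
    lintegral_withDensity_eq_lintegral_mul _ (measurable_gaussianPDF 0 1)
      ((by fun_prop : Measurable fun x => ENNReal.ofReal (Real.exp (b * x))).indicator
        measurableSet_Ici),
    withDensity_apply _ measurableSet_Ici, ← lintegral_const_mul _ (measurable_gaussianPDF 0 1),
    ← lintegral_indicator measurableSet_Ici,
    -- Completing the square: the tilt by `exp(bx)` translates the Gaussian density by `b`.
    ← lintegral_sub_right_eq_self (fun x => (Set.Ici (a - b)).indicator
      (fun x => ENNReal.ofReal (Real.exp (b ^ 2 / 2)) * gaussianPDF 0 1 x) x) b]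
  refine lintegral_congr fun x => ?_
  by_cases hx : a ≤ x
  · rw [Pi.mul_apply, Set.indicator_of_mem (Set.mem_Ici.2 hx),
      Set.indicator_of_mem (Set.mem_Ici.2 (by linarith)), gaussianPDF, gaussianPDF,
      ← ENNReal.ofReal_mul (gaussianPDFReal_nonneg _ _ _), ← ENNReal.ofReal_mul (Real.exp_nonneg _),
      gaussianPDFReal_zero_one, gaussianPDFReal_zero_one, mul_left_comm (Real.exp (b ^ 2 / 2)),
      mul_assoc, ← Real.exp_add, ← Real.exp_add]
    ring_nf
  · rw [Pi.mul_apply, Set.indicator_of_notMem (by simpa using hx),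
      Set.indicator_of_notMem (by simpa using hx), mul_zero]

theorem lintegral_exp_gaussianReal (b : ℝ) :
    ∫⁻ x, ENNReal.ofReal (Real.exp (b * x)) ∂(gaussianReal 0 1) =
      ENNReal.ofReal (Real.exp (b ^ 2 / 2)) := by
  rw [← ofReal_integral_eq_lintegral_ofReal (integrable_exp_mul_gaussianReal b)
    (ae_of_all _ fun x => Real.exp_nonneg _)]
  have := mgf_gaussianReal (p := gaussianReal 0 1) (X := id) (μ := 0) (v := 1) (by simp) b
  simp only [mgf, id] at this
  rw [this]
  simp

theorem setIntegral_exp_Ici_gaussianReal (b : ℝ) :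
    ∫ x in Set.Ici 0, Real.exp (b * x) ∂(gaussianReal 0 1) =
      Real.exp (b ^ 2 / 2) * cdf (gaussianReal 0 1) b := by
  rw [integral_eq_lintegral_of_nonneg_ae (ae_of_all _ fun x => Real.exp_nonneg _) (by fun_prop),
    setLIntegral_exp_Ici_gaussianReal, sub_zero, ENNReal.toReal_ofReal]
  exact mul_nonneg (Real.exp_nonneg _) (cdf_nonneg _ _)

/-- Convexity of `l ^ 2 / 2 + log Φ(l)`, as a tangent bound at the critical point. -/
theorem tangent_le_exp_mul_cdf {c : ℝ}
    (h : c * cdf (gaussianReal 0 1) c = gaussianPDFReal 0 1 c) (l : ℝ) :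
    Real.exp (2 * c * (l - c)) * (Real.exp (c ^ 2 / 2) * cdf (gaussianReal 0 1) c) ≤
      Real.exp (l ^ 2 / 2) * cdf (gaussianReal 0 1) l := by
  set μ := (gaussianReal 0 1).restrict (Set.Ici 0) with hμ
  have hint : ∀ t, Integrable (fun x => Real.exp (t * x)) μ := fun t =>
    (integrable_exp_mul_gaussianReal t).restrict
  have hset : integrableExpSet id μ = Set.univ := Set.eq_univ_of_forall hint
  have hmgf : mgf id μ = fun t => Real.exp (t ^ 2 / 2) * cdf (gaussianReal 0 1) t := by
    ext t
    rw [← setIntegral_exp_Ici_gaussianReal]; rfl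
  have hder := hasDerivAt_mgf (X := id) (μ := μ) (t := c) (by simp [hset])
  have hintx : Integrable (fun x => x * Real.exp (c * x)) μ := by
    have := integrable_pow_mul_exp_of_mem_interior_integrableExpSet (X := id) (μ := μ) (v := c)
      (by simp [hset]) 1
    simpa using this
  rw [hmgf] at hder
  -- Criticality makes the mean of the tilted half-line Gaussian exactly `2c`; this is why `l = c`
  -- is optimal for `x = 2c`.
  have hmean : ∫ x, x * Real.exp (c * x) ∂μ =
      2 * c * (Real.exp (c ^ 2 / 2) * cdf (gaussianReal 0 1) c) := by
    refine hder.unique (HasDerivAt.congr_deriv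
      ((((hasDerivAt_id c).pow 2).div_const 2).exp.mul (hasDerivAt_cdf_gaussianReal c)) ?_)
    rw [← h]
    simp; ring
  calc Real.exp (2 * c * (l - c)) * (Real.exp (c ^ 2 / 2) * cdf (gaussianReal 0 1) c)
      = ∫ x, Real.exp (2 * c * (l - c)) * ((1 - (l - c) * (2 * c)) * Real.exp (c * x)
          + (l - c) * (x * Real.exp (c * x))) ∂μ := by
        rw [integral_const_mul, integral_add ((hint c).const_mul _) (hintx.const_mul _),
          integral_const_mul, integral_const_mul, hmean, setIntegral_exp_Ici_gaussianReal]
        ring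
    -- Jensen's inequality by hand: `1 + y ≤ exp y` with `y = (l - c)(x - 2c)`, whose mean under the
    -- tilted measure is zero.
    _ ≤ ∫ x, Real.exp (l * x) ∂μ := by
        refine integral_mono ((((hint c).const_mul _).add (hintx.const_mul _)).const_mul _)
          (hint l) fun x => ?_
        have h1 : Real.exp (l * x) = Real.exp (2 * c * (l - c)) *
            (Real.exp ((l - c) * (x - 2 * c)) * Real.exp (c * x)) := by
          rw [← Real.exp_add, ← Real.exp_add]; ring_nf
        simp only
        rw [h1]
        refine mul_le_mul_of_nonneg_left ?_ (Real.exp_nonneg _)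
        nlinarith [mul_le_mul_of_nonneg_right (Real.add_one_le_exp ((l - c) * (x - 2 * c)))
          (Real.exp_nonneg (c * x))]
    _ = _ := setIntegral_exp_Ici_gaussianReal l

/-! ### The rate function and the maximizer of `R` -/

theorem phi_eq (l : ℝ) : phi l = Real.log 2 + Real.log (cdf (gaussianReal 0 1) l) :=
  Real.log_mul two_ne_zero (cdf_gaussianReal_pos l).ne'

/-- Logarithm of the tangent bound for `Φ`. The quadratic gap gives uniqueness of the maximizer and,
at `u = 0`, positivity of the maximum. -/
theorem phi_sub_sq_le {c : ℝ} (hc : 0 < c)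
    (h : c * cdf (gaussianReal 0 1) c = gaussianPDFReal 0 1 c) (u : ℝ) :
    phi u - u ^ 2 / 2 ≤ phi c - c ^ 2 / 2 - (u - c) ^ 2 / 2 := by
  have := Real.log_le_log (cdf_gaussianReal_pos u) (cdf_le_tangent hc h u)
  rw [Real.log_mul (cdf_gaussianReal_pos c).ne' (Real.exp_ne_zero _), Real.log_exp] at this
  rw [phi_eq, phi_eq]
  linarith

theorem muStar_two_mul {c : ℝ} (hc : 0 < c)
    (h : c * cdf (gaussianReal 0 1) c = gaussianPDFReal 0 1 c) :
    muStar (2 * c) = c * (2 * c) - c ^ 2 / 2 - phi c := by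
  refine IsGreatest.csSup_eq ⟨⟨c, hc.le, rfl⟩, ?_⟩
  rintro _ ⟨l, -, rfl⟩
  have hp := cdf_gaussianReal_pos
  have := Real.log_le_log (by have := hp c; positivity) (tangent_le_exp_mul_cdf h l)
  rw [Real.log_mul (Real.exp_ne_zero _) (by have := hp c; positivity),
    Real.log_mul (Real.exp_ne_zero _) (hp c).ne', Real.log_mul (Real.exp_ne_zero _) (hp l).ne',
    Real.log_exp, Real.log_exp, Real.log_exp] at this
  simp only [phi_eq]
  linarith

theorem R_two_mul {c : ℝ} (hc : 0 < c)
    (h : c * cdf (gaussianReal 0 1) c = gaussianPDFReal 0 1 c) :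
    R (2 * c) = phi c - c ^ 2 / 2 := by
  rw [R, muStar_two_mul hc h]
  ring

theorem R_lt_of_ne {c : ℝ} (hc : 0 < c)
    (h : c * cdf (gaussianReal 0 1) c = gaussianPDFReal 0 1 c) {x : ℝ} (hx : 0 ≤ x)
    (hne : x ≠ 2 * c) : R x < R (2 * c) := by
  have h1 : x / 2 * x - (x / 2) ^ 2 / 2 - phi (x / 2) ≤ muStar x :=
    le_csSup (bddAbove_legendreValues x) ⟨x / 2, Set.mem_Ici.2 (by linarith), rfl⟩
  have h2 := phi_sub_sq_le hc h (x / 2)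
  have h3 : 0 < (x / 2 - c) ^ 2 := by
    have : x / 2 - c ≠ 0 := fun h0 => hne (by linarith)
    positivity
  rw [R_two_mul hc h, R]
  linarith

theorem R_two_mul_pos {c : ℝ} (hc : 0 < c)
    (h : c * cdf (gaussianReal 0 1) c = gaussianPDFReal 0 1 c) : 0 < R (2 * c) := by
  have := phi_sub_sq_le hc h 0
  rw [phi_zero] at this
  rw [R_two_mul hc h]
  nlinarith [sq_pos_of_pos hc]

/-! ### Local fields and their joint law -/

/-- The law of a Gaussian vector built linearly from independent standard normal variables is
determined by the variances of its linear functionals. -/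
theorem charFun_map_of_linear {Ω ι κ : Type*} [MeasurableSpace Ω] [Fintype ι] [Fintype κ]
    {P : Measure Ω} {G : ι → Ω → ℝ} (hG : ∀ i, Measurable (G i)) (hind : iIndepFun G P)
    (hlaw : ∀ i, P.map (G i) = gaussianReal 0 1) {X : Ω → κ → ℝ} (hX : Measurable X)
    (t : EuclideanSpace ℝ κ) (a : ι → ℝ) (ha : ∀ ω, ∑ k, t k * X ω k = ∑ i, a i * G i ω) :
    charFun ((P.map X).map (WithLp.toLp 2)) t = Complex.exp (-((∑ i, a i ^ 2 : ℝ) : ℂ) / 2) := by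
  have h1 := hind.map_fun_eq_pi_map fun i => (hG i).aemeasurable
  simp only [hlaw] at h1
  have h2 := charFun_pi (μ := fun _ : ι => gaussianReal 0 1) (WithLp.toLp 2 a)
  rw [← h1] at h2
  have hGm : Measurable fun ω i => G i ω := measurable_pi_lambda _ hG
  have e : charFun ((P.map X).map (WithLp.toLp 2)) t =
      charFun ((P.map fun ω i => G i ω).map (WithLp.toLp 2)) (WithLp.toLp 2 a) := by
    rw [Measure.map_map (by fun_prop) hX, Measure.map_map (by fun_prop) hGm, charFun, charFun,
      integral_map (by fun_prop) (by fun_prop), integral_map (by fun_prop) (by fun_prop)]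
    refine integral_congr_ae (ae_of_all _ fun ω => ?_)
    simp only [PiLp.inner_apply, Function.comp_apply, RCLike.inner_apply, conj_trivial]
    rw [ha]
  rw [e, h2]
  simp only [charFun_gaussianReal, ← Complex.exp_sum]
  congr 1
  push_cast
  rw [neg_div, Finset.sum_div, ← Finset.sum_neg_distrib]
  refine Finset.sum_congr rfl fun i _ => ?_
  simp

theorem two_mul_sum_Ioi {n : ℕ} (F : Fin n → Fin n → ℝ) (hF : ∀ i j, F i j = F j i) :
    2 * ∑ i, ∑ j ∈ Finset.Ioi i, F i j = ∑ i, ∑ j, F i j - ∑ i, F i i := by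
  have h1 : ∑ i, ∑ j ∈ Finset.Ioi i, F i j = ∑ i, ∑ j ∈ Finset.Iio i, F i j := by
    rw [Finset.sum_comm' (t' := Finset.univ) (s' := fun j => Finset.Iio j) (by simp)]
    exact Finset.sum_congr rfl fun i _ => Finset.sum_congr rfl fun j _ => hF j i
  have h2 : ∀ i, ∑ j, F i j = ∑ j ∈ Finset.Ioi i, F i j + ∑ j ∈ Finset.Iio i, F i j + F i i := by
    intro i
    rw [← Finset.sum_filter_add_sum_filter_not Finset.univ (fun j => i < j),
      ← Finset.sum_filter_add_sum_filter_not (Finset.univ.filter fun j => ¬ i < j) (fun j => j < i),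
      add_assoc]
    congr 1
    · congr 1; ext; simp
    · congr 1
      · congr 1; ext j; simp; exact le_of_lt
      · rw [Finset.sum_eq_single_of_mem i (by simp)]
        intro j hj hne
        simp at hj
        exact absurd (le_antisymm hj.1 hj.2) hne
  simp_rw [h2, Finset.sum_add_distrib, ← h1]
  ring

theorem sum_lt_pairs {n : ℕ} (F : Fin n → Fin n → ℝ) :
    ∑ p : {p : Fin n × Fin n // p.1 < p.2}, F p.1.1 p.1.2 = ∑ i, ∑ j ∈ Finset.Ioi i, F i j := by
  rw [Finset.sum_sigma', ← Finset.sum_subtype (s := Finset.univ.filter fun p : Fin n × Fin n =>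
    p.1 < p.2) (by simp) (fun p => F p.1 p.2)]
  exact Finset.sum_nbij' (fun p => ⟨p.1, p.2⟩) (fun p => (p.1, p.2)) (by simp) (by simp)
    (by simp) (by simp) (by simp)

theorem spin_mul_self (s : ℤˣ) : spin s * spin s = 1 := by
  rw [spin, ← Int.cast_mul, ← Units.val_mul, Int.units_mul_self]; simp

/-- The local field at site `i`; it equals half the change of energy when spin `i` is flipped. -/
def localField {n : ℕ} (W : Matrix (Fin n) (Fin n) ℝ) (σ : Config n) (i : Fin n) : ℝ :=
  -∑ j, spin (σ i) * spin (σ j) * W i j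

theorem hamiltonian_eq {n : ℕ} {W : Matrix (Fin n) (Fin n) ℝ} (hs : W.IsSymm)
    (hd : ∀ i, W i i = 0) (σ : Config n) :
    2 * hamiltonian W σ = ∑ i, ∑ j, spin (σ i) * spin (σ j) * W i j := by
  rw [hamiltonian, two_mul_sum_Ioi _ fun i j => by rw [hs.apply]; ring]
  simp [hd]

theorem hamiltonian_eq_sum_localField {n : ℕ} {W : Matrix (Fin n) (Fin n) ℝ} (hs : W.IsSymm)
    (hd : ∀ i, W i i = 0) (σ : Config n) :
    hamiltonian W σ = -(1 / 2) * ∑ i, localField W σ i := by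
  have := hamiltonian_eq hs hd σ
  simp only [localField, Finset.sum_neg_distrib]
  linarith

theorem hamiltonian_flip {n : ℕ} {W : Matrix (Fin n) (Fin n) ℝ} (hs : W.IsSymm)
    (hd : ∀ i, W i i = 0) (σ : Config n) (i : Fin n) :
    hamiltonian W (flip σ i) = hamiltonian W σ + 2 * localField W σ i := by
  have hsp : ∀ a, spin (flip σ i a) = spin (σ a) - if a = i then 2 * spin (σ a) else 0 := by
    intro a
    by_cases h : a = i
    · subst h; simp [flip, spin]; ring
    · simp [flip, h]
  have hsym : ∑ a, spin (σ a) * spin (σ i) * W a i = ∑ a, spin (σ i) * spin (σ a) * W i a :=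
    Finset.sum_congr rfl fun a _ => by rw [hs.apply]; ring
  have h2 : ∑ a, ∑ b, spin (flip σ i a) * spin (flip σ i b) * W a b =
      ∑ a, ∑ b, spin (σ a) * spin (σ b) * W a b - 4 * ∑ b, spin (σ i) * spin (σ b) * W i b := by
    have : ∀ a b, spin (flip σ i a) * spin (flip σ i b) * W a b =
        spin (σ a) * spin (σ b) * W a b - (if a = i then 2 * (spin (σ a) * spin (σ b) * W a b) else 0)
        - (if b = i then 2 * (spin (σ a) * spin (σ b) * W a b) else 0)
        + (if a = i then if b = i then 4 * (spin (σ a) * spin (σ b) * W a b) else 0 else 0) := by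
      intro a b
      rw [hsp, hsp]
      split_ifs <;> ring
    simp only [this, Finset.sum_add_distrib, Finset.sum_sub_distrib, Finset.sum_ite_eq',
      Finset.mem_univ, if_true, Finset.sum_ite_irrel, Finset.sum_const_zero, hd, ← Finset.mul_sum,
      hsym]
    ring
  rw [← hamiltonian_eq hs hd, ← hamiltonian_eq hs hd] at h2
  rw [localField]
  linarith

theorem isLocalMinimum_iff {n : ℕ} {W : Matrix (Fin n) (Fin n) ℝ} (hs : W.IsSymm)
    (hd : ∀ i, W i i = 0) (σ : Config n) :
    IsLocalMinimum W σ ↔ ∀ i, 0 ≤ localField W σ i := by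
  simp [IsLocalMinimum, hamiltonian_flip hs hd]

theorem IsDisorder.measurable_localField {Ω : Type*} [MeasurableSpace Ω] {P : Measure Ω} {n : ℕ}
    {W : Ω → Matrix (Fin n) (Fin n) ℝ} (hW : IsDisorder P W) (σ : Config n) (i : Fin n) :
    Measurable fun ω => localField (W ω) σ i := by
  have := hW.measurable
  unfold localField
  fun_prop

/-- The local fields have the law of `√(n - 2) Nᵢ + N₀` with independent standard normals. -/
theorem IsDisorder.map_localField {Ω : Type*} [MeasurableSpace Ω] {P : Measure Ω}
    [IsProbabilityMeasure P] {n : ℕ} (hn : 2 ≤ n)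
    {W : Ω → Matrix (Fin n) (Fin n) ℝ} (hW : IsDisorder P W) (σ : Config n) :
    P.map (fun ω => localField (W ω) σ) =
      ((gaussianReal 0 1).prod (Measure.pi fun _ : Fin n => gaussianReal 0 1)).map
        (fun q i => √((n : ℝ) - 2) * q.2 i + q.1) := by
  have hn' : (0 : ℝ) ≤ n - 2 := by rw [sub_nonneg]; exact_mod_cast hn
  have hmX : Measurable fun ω => localField (W ω) σ :=
    measurable_pi_lambda _ fun i => hW.measurable_localField σ i
  have hpres := measurePreserving_piFinSuccAbove (fun _ : Fin (n + 1) => gaussianReal 0 1) 0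
  have hmY : Measurable fun (y : Fin (n + 1) → ℝ) (i : Fin n) =>
      √((n : ℝ) - 2) * y i.succ + y 0 := by fun_prop
  have hR : ((gaussianReal 0 1).prod (Measure.pi fun _ : Fin n => gaussianReal 0 1)).map
        (fun q i => √((n : ℝ) - 2) * q.2 i + q.1) =
      (Measure.pi fun _ : Fin (n + 1) => gaussianReal 0 1).map
        fun y i => √((n : ℝ) - 2) * y i.succ + y 0 := by
    rw [← hpres.map_eq, Measure.map_map (by fun_prop) hpres.measurable]
    rfl
  rw [hR]
  have hp1 := Measure.isProbabilityMeasure_map (μ := P) hmX.aemeasurable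
  have hp2 := Measure.isProbabilityMeasure_map
    (μ := Measure.pi fun _ : Fin (n + 1) => gaussianReal 0 1) hmY.aemeasurable
  refine (MeasurableEquiv.toLp 2 (Fin n → ℝ)).map_measurableEquiv_injective
    (Measure.ext_of_charFun (E := EuclideanSpace ℝ (Fin n)) (funext fun t => ?_))
  rw [MeasurableEquiv.coe_toLp,
    charFun_map_of_linear
      (G := fun (p : {p : Fin n × Fin n // p.1 < p.2}) ω => W ω p.1.1 p.1.2)
      (fun p => hW.measurable p.1.1 p.1.2) hW.indep
      (fun p => hW.law p.1.1 p.1.2 p.2) hmX t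
      -- Each coupling enters two local fields, so its coefficient carries `t i + t j`. The two
      -- variances agree because `∑_{i<j} (t i + t j)² = (n-2) ∑ t i² + (∑ t i)²`.
      (fun p => -((t p.1.1 + t p.1.2) * (spin (σ p.1.1) * spin (σ p.1.2)))) fun ω => ?_,
    charFun_map_of_linear (fun i => measurable_pi_apply i)
      (iIndepFun_pi (X := fun _ x => x) fun _ => aemeasurable_id)
      (fun i => (measurePreserving_eval _ i).map_eq) hmY t
      (Fin.cons (∑ k, t k) fun k => √((n : ℝ) - 2) * t k) fun y => ?_]
  · congr 4
    rw [Fin.sum_univ_succ]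
    simp only [Fin.cons_zero, Fin.cons_succ, mul_pow, Real.sq_sqrt hn', neg_sq]
    have hsq : ∀ i, spin (σ i) ^ 2 = 1 := fun i => by rw [sq, spin_mul_self]
    simp only [hsq, mul_one]
    rw [sum_lt_pairs fun i j => (t i + t j) ^ 2]
    have := two_mul_sum_Ioi (fun i j => (t i + t j) ^ 2) fun i j => by ring
    have e1 : ∑ i, ∑ j, (t i + t j) ^ 2 = 2 * n * ∑ i, t i ^ 2 + 2 * (∑ k, t k) ^ 2 := by
      simp only [add_sq, Finset.sum_add_distrib, Finset.sum_const, Finset.card_univ,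
        Fintype.card_fin, nsmul_eq_mul, ← Finset.mul_sum, ← Finset.sum_mul]
      ring
    have e2 : ∑ i, (t i + t i) ^ 2 = 4 * ∑ i, t i ^ 2 := by
      rw [Finset.mul_sum]; exact Finset.sum_congr rfl fun i _ => by ring
    rw [e1, e2] at this
    rw [← Finset.mul_sum]
    linarith
  · rw [Fin.sum_univ_succ]
    simp only [Fin.cons_zero, Fin.cons_succ, mul_add, Finset.sum_add_distrib, Finset.sum_mul]
    rw [add_comm]
    congr 1
    exact Finset.sum_congr rfl fun i _ => by ring
  · have hs := hW.symm ω
    have hd := hW.diag ω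
    rw [sum_lt_pairs fun i j => -((t i + t j) * (spin (σ i) * spin (σ j))) * W ω i j]
    have := two_mul_sum_Ioi
      (fun i j => -((t i + t j) * (spin (σ i) * spin (σ j))) * W ω i j)
      fun i j => by rw [hs.apply]; ring
    simp only [hd, mul_zero, Finset.sum_const_zero, sub_zero] at this
    have e : ∑ i, ∑ j, -((t i + t j) * (spin (σ i) * spin (σ j))) * W ω i j =
        2 * ∑ k, t k * localField (W ω) σ k := by
      have h1 : ∑ i, ∑ j, t j * (spin (σ i) * spin (σ j) * W ω i j) =
          ∑ i, ∑ j, t i * (spin (σ i) * spin (σ j) * W ω i j) := by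
        rw [Finset.sum_comm]
        exact Finset.sum_congr rfl fun i _ => Finset.sum_congr rfl fun j _ => by
          rw [hs.apply]; ring
      have h2 : ∀ i j, -((t i + t j) * (spin (σ i) * spin (σ j))) * W ω i j =
          -(t i * (spin (σ i) * spin (σ j) * W ω i j))
          - t j * (spin (σ i) * spin (σ j) * W ω i j) := fun i j => by ring
      have h3 : ∑ k, t k * localField (W ω) σ k =
          -∑ i, ∑ j, t i * (spin (σ i) * spin (σ j) * W ω i j) := by
        simp only [localField, mul_neg, Finset.mul_sum, Finset.sum_neg_distrib]
      simp only [h2, Finset.sum_sub_distrib, Finset.sum_neg_distrib, h1, h3]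
      ring
    linarith

/-! ### Bounds for the probability of local optimality -/

section LocalFields

variable {Ω : Type*} [MeasurableSpace Ω] {P : Measure Ω} {n : ℕ}
  {W : Ω → Matrix (Fin n) (Fin n) ℝ}

theorem setOf_isLocalMinimum (hW : IsDisorder P W) (σ : Config n) :
    {ω | IsLocalMinimum (W ω) σ} = ⋂ i, {ω | 0 ≤ localField (W ω) σ i} := by
  ext ω
  simp [isLocalMinimum_iff (hW.symm ω) (hW.diag ω)]

theorem measurableSet_isLocalMinimum (hW : IsDisorder P W) (σ : Config n) :
    MeasurableSet {ω | IsLocalMinimum (W ω) σ} := by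
  rw [setOf_isLocalMinimum hW]
  exact .iInter fun i => measurableSet_le measurable_const (hW.measurable_localField σ i)

variable [IsProbabilityMeasure P]

/-- Condition on the common Gaussian `z`: the fields become independent and identically distributed,
so the product integrates to an `n`-th power. -/
theorem lintegral_prod_localField (hn : 2 ≤ n) (hW : IsDisorder P W) (σ : Config n)
    {h : ℝ → ENNReal} (hh : Measurable h) :
    ∫⁻ ω, ∏ i, h (localField (W ω) σ i) ∂P =
      ∫⁻ z, (∫⁻ y, h (√((n : ℝ) - 2) * y + z) ∂(gaussianReal 0 1)) ^ n ∂(gaussianReal 0 1) := by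
  have hmX : Measurable fun ω => localField (W ω) σ :=
    measurable_pi_lambda _ fun i => hW.measurable_localField σ i
  have hmh : Measurable fun x : Fin n → ℝ => ∏ i, h (x i) := by fun_prop
  calc ∫⁻ ω, ∏ i, h (localField (W ω) σ i) ∂P
      = ∫⁻ x, ∏ i, h (x i) ∂(P.map fun ω => localField (W ω) σ) := (lintegral_map hmh hmX).symm
    _ = ∫⁻ z, ∫⁻ y, ∏ i, h (√((n : ℝ) - 2) * y i + z) ∂(Measure.pi fun _ : Fin n =>
          gaussianReal 0 1) ∂(gaussianReal 0 1) := by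
        rw [hW.map_localField hn, lintegral_map hmh (by fun_prop), lintegral_prod]
        fun_prop
    _ = _ := by
        refine lintegral_congr fun z => ?_
        have hm : Measurable fun y : ℝ => h (√((n : ℝ) - 2) * y + z) := by fun_prop
        rw [lintegral_prod_eq_prod_lintegral_of_indepFun Finset.univ
          (fun (i : Fin n) (y : Fin n → ℝ) => h (√((n : ℝ) - 2) * y i + z))
          (iIndepFun_pi (X := fun _ y => h (√((n : ℝ) - 2) * y + z)) fun _ => hm.aemeasurable)
          fun i => hm.comp (measurable_pi_apply i)]
        have : ∀ i : Fin n, ∫⁻ y : Fin n → ℝ, h (√((n : ℝ) - 2) * y i + z)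
            ∂(Measure.pi fun _ : Fin n => gaussianReal 0 1) =
            ∫⁻ y, h (√((n : ℝ) - 2) * y + z) ∂(gaussianReal 0 1) := fun i =>
          (measurePreserving_eval (fun _ : Fin n => gaussianReal 0 1) i).lintegral_comp hm
        simp [this]

theorem lintegral_indicator_exp_affine {r : ℝ} (hr : 0 < r) (t z : ℝ) :
    ∫⁻ y, (Set.Ici 0).indicator (fun x => ENNReal.ofReal (Real.exp (t * x))) (r * y + z)
      ∂(gaussianReal 0 1) = ENNReal.ofReal (Real.exp (t * z + (t * r) ^ 2 / 2) *
        cdf (gaussianReal 0 1) (t * r + z / r)) := by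
  have h : ∀ y, (Set.Ici 0).indicator (fun x => ENNReal.ofReal (Real.exp (t * x))) (r * y + z) =
      (Set.Ici (-z / r)).indicator (fun y => ENNReal.ofReal (Real.exp (t * z)) *
        ENNReal.ofReal (Real.exp (t * r * y))) y := fun y => by
    have : 0 ≤ r * y + z ↔ -z / r ≤ y := by
      rw [div_le_iff₀ hr]; constructor <;> intro h <;> linarith
    by_cases hy : -z / r ≤ y
    · rw [Set.indicator_of_mem (Set.mem_Ici.2 (this.2 hy)), Set.indicator_of_mem (Set.mem_Ici.2 hy),
        ← ENNReal.ofReal_mul (Real.exp_nonneg _), ← Real.exp_add]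
      ring_nf
    · rw [Set.indicator_of_notMem (s := Set.Ici 0) fun h => hy (this.1 h),
        Set.indicator_of_notMem (s := Set.Ici _) hy]
  simp only [h]
  rw [lintegral_indicator measurableSet_Ici, lintegral_const_mul _ (by fun_prop),
    setLIntegral_exp_Ici_gaussianReal, ← ENNReal.ofReal_mul (Real.exp_nonneg _), ← mul_assoc,
    ← Real.exp_add]
  congr 4
  ring

theorem lintegral_prod_indicator_exp_le {c : ℝ} (hc : 0 < c)
    (h : c * cdf (gaussianReal 0 1) c = gaussianPDFReal 0 1 c) (hn : 3 ≤ n)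
    (hW : IsDisorder P W) (σ : Config n) (s : ℝ) :
    ∫⁻ ω, ∏ i, (Set.Ici 0).indicator
        (fun x => ENNReal.ofReal (Real.exp (s / √((n : ℝ) - 2) * x))) (localField (W ω) σ i) ∂P ≤
      ENNReal.ofReal (Real.exp (n * (s ^ 2 + 2 * c * s +
        (Real.log (cdf (gaussianReal 0 1) c) - c ^ 2 / 2)) + 3 * (s + c) ^ 2)) := by
  have hn3 : (3 : ℝ) ≤ n := by exact_mod_cast hn
  set r := √((n : ℝ) - 2) with hr
  have hr0 : 0 < r := Real.sqrt_pos.2 (by linarith)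
  have hr2 : r ^ 2 = n - 2 := Real.sq_sqrt (by linarith)
  rw [lintegral_prod_localField (by omega) hW σ ((by fun_prop : Measurable
    fun x => ENNReal.ofReal (Real.exp (s / r * x))).indicator measurableSet_Ici)]
  simp only [← hr, lintegral_indicator_exp_affine hr0, div_mul_cancel₀ _ hr0.ne']
  set k := Real.log (cdf (gaussianReal 0 1) c) with hk
  have hpt : ∀ z, (ENNReal.ofReal (Real.exp (s / r * z + s ^ 2 / 2) *
      cdf (gaussianReal 0 1) (s + z / r))) ^ n ≤
      ENNReal.ofReal (Real.exp (n * (s ^ 2 / 2 + c * s - c ^ 2 + k))) *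
        ENNReal.ofReal (Real.exp (n * ((s + c) / r) * z)) := fun z => by
    rw [← ENNReal.ofReal_pow (mul_nonneg (Real.exp_nonneg _) (cdf_nonneg _ _)),
      ← ENNReal.ofReal_mul (Real.exp_nonneg _)]
    refine ENNReal.ofReal_le_ofReal ?_
    have h1 : Real.exp (s / r * z + s ^ 2 / 2) * cdf (gaussianReal 0 1) (s + z / r) ≤
        Real.exp (s / r * z + s ^ 2 / 2) * Real.exp (k + c * (s + z / r - c)) := by
      refine mul_le_mul_of_nonneg_left ?_ (Real.exp_nonneg _)
      rw [Real.exp_add, hk, Real.exp_log (cdf_gaussianReal_pos c)]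
      exact cdf_le_tangent hc h _
    refine (pow_le_pow_left₀ (mul_nonneg (Real.exp_nonneg _) (cdf_nonneg _ _)) h1 n).trans_eq ?_
    rw [← Real.exp_add, ← Real.exp_add, ← Real.exp_nat_mul]
    congr 1
    ring
  refine (lintegral_mono hpt).trans ?_
  rw [lintegral_const_mul _ (by fun_prop), lintegral_exp_gaussianReal,
    ← ENNReal.ofReal_mul (Real.exp_nonneg _), ← Real.exp_add]
  refine ENNReal.ofReal_le_ofReal (Real.exp_le_exp.2 ?_)
  -- Replacing `n²/(n-2)` by `n` in the Gaussian exponent costs at most `6`, halved to the `3` of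
  -- the statement.
  have h2 : (n : ℝ) ^ 2 / r ^ 2 ≤ n + 6 := by
    rw [hr2, div_le_iff₀ (by linarith)]
    nlinarith
  have h3 : (n * ((s + c) / r)) ^ 2 = (n : ℝ) ^ 2 / r ^ 2 * (s + c) ^ 2 := by
    field_simp
  rw [h3]
  nlinarith [mul_le_mul_of_nonneg_right h2 (sq_nonneg (s + c))]

/-- Chernoff bound for the sum of the local fields on the event of local optimality. -/
theorem measureReal_isLocalMinimum_inter_le {c : ℝ} (hc : 0 < c)
    (h : c * cdf (gaussianReal 0 1) c = gaussianPDFReal 0 1 c) (hn : 3 ≤ n)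
    (hW : IsDisorder P W) (σ : Config n) (s a : ℝ) :
    P.real {ω | IsLocalMinimum (W ω) σ ∧ s * a ≤ s * ∑ i, localField (W ω) σ i} ≤
      Real.exp (n * (s ^ 2 + 2 * c * s + (Real.log (cdf (gaussianReal 0 1) c) - c ^ 2 / 2)) +
        3 * (s + c) ^ 2 - s * a / √((n : ℝ) - 2)) := by
  have hn3 : (3 : ℝ) ≤ n := by exact_mod_cast hn
  have hU := lintegral_prod_indicator_exp_le hc h hn hW σ s
  set r := √((n : ℝ) - 2) with hr
  have hr0 : 0 < r := Real.sqrt_pos.2 (by linarith)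
  set E := {ω | IsLocalMinimum (W ω) σ ∧ s * a ≤ s * ∑ i, localField (W ω) σ i} with hE
  set F : Ω → ENNReal := fun ω => ∏ i, (Set.Ici 0).indicator
    (fun x => ENNReal.ofReal (Real.exp (s / r * x))) (localField (W ω) σ i) with hF
  have hFm : Measurable F := Finset.measurable_fun_prod _ fun i _ =>
    ((by fun_prop : Measurable fun x => ENNReal.ofReal (Real.exp (s / r * x))).indicator
      measurableSet_Ici).comp (hW.measurable_localField σ i)
  have hsub : E ⊆ {ω | ENNReal.ofReal (Real.exp (s * a / r)) ≤ F ω} := by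
    rintro ω ⟨hmin, hs⟩
    rw [isLocalMinimum_iff (hW.symm ω) (hW.diag ω)] at hmin
    have : F ω = ENNReal.ofReal (Real.exp (s / r * ∑ i, localField (W ω) σ i)) := by
      rw [Finset.mul_sum, Real.exp_sum, ENNReal.ofReal_prod_of_nonneg
        fun i _ => Real.exp_nonneg _]
      exact Finset.prod_congr rfl fun i _ => Set.indicator_of_mem (Set.mem_Ici.2 (hmin i)) _
    rw [Set.mem_ofPred_eq, this]
    refine ENNReal.ofReal_le_ofReal (Real.exp_le_exp.2 ?_)
    rw [div_mul_eq_mul_div]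
    gcongr
  have h1 := (mul_meas_ge_le_lintegral (μ := P) hFm (ENNReal.ofReal (Real.exp (s * a / r)))).trans hU
  have h2 := (mul_le_mul_right (measure_mono (μ := P) hsub)
    (ENNReal.ofReal (Real.exp (s * a / r)))).trans h1
  rw [← ofReal_measureReal, ← ENNReal.ofReal_mul (Real.exp_nonneg _),
    ENNReal.ofReal_le_ofReal_iff (Real.exp_nonneg _)] at h2
  rw [Real.exp_sub, le_div_iff₀ (Real.exp_pos _), mul_comm]
  exact h2

theorem measureReal_isLocalMinimum_le {c : ℝ} (hc : 0 < c)
    (h : c * cdf (gaussianReal 0 1) c = gaussianPDFReal 0 1 c) (hn : 3 ≤ n)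
    (hW : IsDisorder P W) (σ : Config n) :
    P.real {ω | IsLocalMinimum (W ω) σ} ≤
      Real.exp (n * (Real.log (cdf (gaussianReal 0 1) c) - c ^ 2 / 2) + 3 * c ^ 2) := by
  simpa using measureReal_isLocalMinimum_inter_le hc h hn hW σ 0 0

theorem exp_neg_one_le_inv_sqrt_two_mul_pi : Real.exp (-1) ≤ (√(2 * Real.pi))⁻¹ := by
  rw [Real.exp_neg]
  refine inv_anti₀ (by positivity) (Real.sqrt_le_iff.2 ⟨(Real.exp_pos _).le, ?_⟩)
  nlinarith [Real.exp_one_gt_d9, Real.pi_lt_d2]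

theorem le_gaussianReal_Icc {a : ℝ} (ha : 0 ≤ a) :
    ENNReal.ofReal (Real.exp (-(a ^ 2 / 2) - a - 3 / 2)) ≤
      gaussianReal 0 1 (Set.Icc a (a + 1)) := by
  rw [gaussianReal_apply _ one_ne_zero]
  calc ENNReal.ofReal (Real.exp (-(a ^ 2 / 2) - a - 3 / 2))
      = ∫⁻ x in Set.Icc a (a + 1), ENNReal.ofReal (Real.exp (-(a ^ 2 / 2) - a - 3 / 2)) := by
        simp
    _ ≤ _ := by
        refine setLIntegral_mono (measurable_gaussianPDF 0 1) fun x hx => ?_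
        refine ENNReal.ofReal_le_ofReal ?_
        rw [gaussianPDFReal_zero_one]
        -- The density on the interval is smallest at `a + 1`; the `-1` bounds the normalizing
        -- constant.
        have : -(a ^ 2 / 2) - a - 3 / 2 = -1 + -(a + 1) ^ 2 / 2 := by ring
        rw [this, Real.exp_add]
        refine mul_le_mul exp_neg_one_le_inv_sqrt_two_mul_pi (Real.exp_le_exp.2 ?_)
          (Real.exp_nonneg _) (by positivity)
        have := pow_le_pow_left₀ (ha.trans hx.1) hx.2 2
        linarith

theorem le_measureReal_isLocalMinimum {c : ℝ} (hc : 0 < c) (hc1 : c < 1) (hn : 3 ≤ n)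
    (hW : IsDisorder P W) (σ : Config n) :
    Real.exp (n * (Real.log (cdf (gaussianReal 0 1) c) - c ^ 2 / 2) - √(n : ℝ) - 2) ≤
      P.real {ω | IsLocalMinimum (W ω) σ} := by
  have hn3 : (3 : ℝ) ≤ n := by exact_mod_cast hn
  set r := √((n : ℝ) - 2) with hr
  have hr0 : 0 < r := Real.sqrt_pos.2 (by linarith)
  have hr2 : r ^ 2 = n - 2 := Real.sq_sqrt (by linarith)
  have hrn : r ≤ √(n : ℝ) := Real.sqrt_le_sqrt (by linarith)
  set p := cdf (gaussianReal 0 1) c with hp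
  have hp0 : 0 < p := cdf_gaussianReal_pos c
  set E := {ω | IsLocalMinimum (W ω) σ} with hE
  have hEi : E = ⋂ i, {ω | 0 ≤ localField (W ω) σ i} := setOf_isLocalMinimum hW σ
  have hEm : MeasurableSet E := measurableSet_isLocalMinimum hW σ
  have hPE : P E = ∫⁻ z, ENNReal.ofReal (cdf (gaussianReal 0 1) (z / r)) ^ n
      ∂(gaussianReal 0 1) := by
    have h1 := lintegral_prod_localField (by omega) hW σ
      ((measurable_const : Measurable fun _ : ℝ => (1 : ENNReal)).indicator
        (measurableSet_Ici (a := (0 : ℝ))))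
    have h2 : ∀ z, ∫⁻ y, (Set.Ici 0).indicator (fun _ => (1 : ENNReal)) (r * y + z)
        ∂(gaussianReal 0 1) = ENNReal.ofReal (cdf (gaussianReal 0 1) (z / r)) := fun z => by
      simpa using lintegral_indicator_exp_affine hr0 0 z
    simp only [← hr, h2] at h1
    rw [← h1, ← lintegral_indicator_one hEm]
    refine lintegral_congr fun ω => ?_
    by_cases hω : ω ∈ E
    · rw [Set.indicator_of_mem hω, Pi.one_apply, eq_comm]
      rw [hEi, Set.mem_iInter] at hω
      exact Finset.prod_eq_one fun i _ => Set.indicator_of_mem (Set.mem_Ici.2 (hω i)) _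
    · rw [Set.indicator_of_notMem hω, eq_comm]
      rw [hEi, Set.mem_iInter, not_forall] at hω
      obtain ⟨i, hi⟩ := hω
      exact Finset.prod_eq_zero (Finset.mem_univ i) (Set.indicator_of_notMem (s := Set.Ici 0) hi _)
  -- Keep only `z` in a unit interval starting at `c r`, where the upper bound's exponent is maximal
  -- to leading order; there `Φ(z/r) ≥ Φ(c)`.
  have hle : ENNReal.ofReal (p ^ n * Real.exp (-((c * r) ^ 2 / 2) - c * r - 3 / 2)) ≤ P E := by
    rw [hPE, ENNReal.ofReal_mul (by positivity)]
    calc _ ≤ ENNReal.ofReal (p ^ n) * gaussianReal 0 1 (Set.Icc (c * r) (c * r + 1)) :=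
          mul_le_mul_right (le_gaussianReal_Icc (by positivity)) _
      _ = ∫⁻ z in Set.Icc (c * r) (c * r + 1), ENNReal.ofReal (p ^ n) ∂(gaussianReal 0 1) := by
          simp
      _ ≤ ∫⁻ z in Set.Icc (c * r) (c * r + 1), ENNReal.ofReal (cdf (gaussianReal 0 1) (z / r)) ^ n
            ∂(gaussianReal 0 1) := by
          refine setLIntegral_mono' measurableSet_Icc fun z hz => ?_
          rw [ENNReal.ofReal_pow hp0.le]
          gcongr
          exact monotone_cdf _ ((le_div_iff₀ hr0).2 hz.1)
      _ ≤ _ := setLIntegral_le_lintegral _ _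
  rw [← ofReal_measureReal, ENNReal.ofReal_le_ofReal_iff measureReal_nonneg] at hle
  refine le_trans ?_ hle
  rw [← Real.exp_log hp0, ← Real.exp_nat_mul, ← Real.exp_add, Real.log_exp, mul_pow, hr2]
  refine Real.exp_le_exp.2 ?_
  nlinarith [mul_le_mul hc1.le hrn hr0.le zero_le_one, sq_nonneg c]

end LocalFields

/-! ### The exponential rate -/

theorem tendsto_log_measureReal_isLocalMinimum {c : ℝ} (hc : 0 < c) (hc1 : c < 1)
    (h : c * cdf (gaussianReal 0 1) c = gaussianPDFReal 0 1 c)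
    (Ω : ℕ → Type*) [∀ n, MeasurableSpace (Ω n)] (P : ∀ n, Measure (Ω n))
    [∀ n, IsProbabilityMeasure (P n)] (W : ∀ n, Ω n → Matrix (Fin n) (Fin n) ℝ)
    (hW : ∀ n, IsDisorder (P n) (W n)) (σ : ∀ n, Config n) :
    Tendsto (fun n : ℕ => (1 / (n : ℝ)) *
        Real.log ((P n).real {ω | IsLocalMinimum (W n ω) (σ n)}))
      atTop (𝓝 (Real.log (cdf (gaussianReal 0 1) c) - c ^ 2 / 2)) := by
  set κ := Real.log (cdf (gaussianReal 0 1) c) - c ^ 2 / 2 with hκ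
  have hinv : Tendsto (fun n : ℕ => 1 / (n : ℝ)) atTop (𝓝 0) := tendsto_one_div_atTop_nhds_zero_nat
  have hsq : Tendsto (fun n : ℕ => √(1 / (n : ℝ))) atTop (𝓝 0) := by
    simpa only [Real.sqrt_zero, Function.comp_def] using
      (Real.continuous_sqrt.tendsto 0).comp hinv
  have hlo : Tendsto (fun n : ℕ => κ - √(1 / (n : ℝ)) - 2 * (1 / (n : ℝ))) atTop (𝓝 κ) := by
    simpa using (hsq.const_sub κ).sub (hinv.const_mul 2)
  have hup : Tendsto (fun n : ℕ => κ + 3 * c ^ 2 * (1 / (n : ℝ))) atTop (𝓝 κ) := by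
    simpa using (hinv.const_mul (3 * c ^ 2)).const_add κ
  refine tendsto_of_tendsto_of_tendsto_of_le_of_le' hlo hup ?_ ?_
  · filter_upwards [eventually_ge_atTop 3] with n hn
    have hn0 : (0 : ℝ) < n := by exact_mod_cast (by omega : 0 < n)
    have h1 := Real.log_le_log (Real.exp_pos _)
      (le_measureReal_isLocalMinimum hc hc1 hn (hW n) (σ n))
    rw [Real.log_exp, ← hκ] at h1
    refine le_trans (le_of_eq ?_) (mul_le_mul_of_nonneg_left h1 (by positivity))
    have hs : √(1 / (n : ℝ)) = 1 / n * √(n : ℝ) := by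
      rw [Real.sqrt_div zero_le_one, Real.sqrt_one]
      have := Real.mul_self_sqrt hn0.le
      have h0 : 0 < √(n : ℝ) := Real.sqrt_pos.2 hn0
      field_simp
      linarith
    rw [hs]
    field_simp
  · filter_upwards [eventually_ge_atTop 3] with n hn
    have hn0 : (0 : ℝ) < n := by exact_mod_cast (by omega : 0 < n)
    have h1 := Real.log_le_log ((Real.exp_pos _).trans_le
      (le_measureReal_isLocalMinimum hc hc1 hn (hW n) (σ n)))
      (measureReal_isLocalMinimum_le hc h hn (hW n) (σ n))
    rw [Real.log_exp, ← hκ] at h1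
    refine (mul_le_mul_of_nonneg_left h1 (by positivity)).trans (le_of_eq ?_)
    field_simp

/-! ### Concentration of the energy -/

section Concentration

variable {Ω : Type*} [MeasurableSpace Ω] {P : Measure Ω} [IsProbabilityMeasure P] {n : ℕ}
  {W : Ω → Matrix (Fin n) (Fin n) ℝ}

theorem natCast_le_mul_sqrt_div {n : ℕ} (hn : 3 ≤ n) :
    (n : ℝ) ≤ n * √(n : ℝ) / √((n : ℝ) - 2) ∧ n * √(n : ℝ) / √((n : ℝ) - 2) ≤ n + 3 := by
  have hn3 : (3 : ℝ) ≤ n := by exact_mod_cast hn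
  have hr0 : 0 < √((n : ℝ) - 2) := Real.sqrt_pos.2 (by linarith)
  constructor
  · rw [le_div_iff₀ hr0]
    exact mul_le_mul_of_nonneg_left (Real.sqrt_le_sqrt (by linarith)) (by linarith)
  · rw [div_le_iff₀ hr0]
    refine abs_le_of_sq_le_sq' ?_ (by positivity) |>.2
    rw [mul_pow, mul_pow, Real.sq_sqrt (by linarith), Real.sq_sqrt (by linarith)]
    nlinarith

/-- The Chernoff exponent is `s² + 2cs` minus, to leading order, `2s(c + s)` per site, which leaves
`-s²`. The sign of `s` selects the tail. -/
theorem measureReal_isLocalMinimum_tail_le {c : ℝ} (hc : 0 < c) (hc1 : c < 1)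
    (h : c * cdf (gaussianReal 0 1) c = gaussianPDFReal 0 1 c) (hn : 3 ≤ n)
    (hW : IsDisorder P W) (σ : Config n) {s : ℝ} (hs : |s| < c) :
    P.real {ω | IsLocalMinimum (W ω) σ ∧
        s * (2 * (c + s) * (n * √(n : ℝ))) ≤ s * ∑ i, localField (W ω) σ i} ≤
      Real.exp (n * (Real.log (cdf (gaussianReal 0 1) c) - c ^ 2 / 2) - s ^ 2 * n + 24) := by
  refine (measureReal_isLocalMinimum_inter_le hc h hn hW σ s _).trans (Real.exp_le_exp.2 ?_)
  obtain ⟨h1, h2⟩ := natCast_le_mul_sqrt_div hn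
  set q := n * √(n : ℝ) / √((n : ℝ) - 2) with hq
  have hqe : s * (2 * (c + s) * (n * √(n : ℝ))) / √((n : ℝ) - 2) = 2 * (s * (c + s)) * q := by
    rw [hq]; ring
  obtain ⟨hs1, hs2⟩ := abs_lt.1 hs
  -- The cost of `√(n-2)` in place of `√n`; with `3(s + c)² ≤ 12` it makes up the `24`.
  have hprod : -(2 * (s * (c + s)) * (q - n)) ≤ 12 := by
    have : -(s * (c + s)) ≤ 2 := by nlinarith
    nlinarith
  have hsq : (s + c) ^ 2 ≤ 4 := by nlinarith
  rw [hqe]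
  nlinarith

theorem one_sub_exp_le_cond {c : ℝ} (hc : 0 < c) (hc1 : c < 1)
    (h : c * cdf (gaussianReal 0 1) c = gaussianPDFReal 0 1 c) (hn : 3 ≤ n)
    (hW : IsDisorder P W) (σ : Config n) {ε : ℝ} (hε : 0 < ε) (hεc : ε < c) :
    1 - Real.exp (28 * √(n : ℝ) - ε ^ 2 * n) ≤
      (P[|{ω | IsLocalMinimum (W ω) σ}]).real
        {ω | -c - ε ≤ (n : ℝ) ^ (-(3 / 2) : ℝ) * hamiltonian (W ω) σ ∧
          (n : ℝ) ^ (-(3 / 2) : ℝ) * hamiltonian (W ω) σ ≤ -c + ε} := by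
  have hn3 : (3 : ℝ) ≤ n := by exact_mod_cast hn
  have hlow := le_measureReal_isLocalMinimum hc hc1 hn hW σ
  have hup := measureReal_isLocalMinimum_tail_le hc hc1 h hn hW σ (s := ε) (by rwa [abs_of_pos hε])
  have hdown := measureReal_isLocalMinimum_tail_le hc hc1 h hn hW σ (s := -ε)
    (by rwa [abs_neg, abs_of_pos hε])
  set κ := Real.log (cdf (gaussianReal 0 1) c) - c ^ 2 / 2 with hκ
  set A := {ω | IsLocalMinimum (W ω) σ} with hA
  set B := {ω | -c - ε ≤ (n : ℝ) ^ (-(3 / 2) : ℝ) * hamiltonian (W ω) σ ∧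
    (n : ℝ) ^ (-(3 / 2) : ℝ) * hamiltonian (W ω) σ ≤ -c + ε} with hB
  set U := {ω | IsLocalMinimum (W ω) σ ∧
    ε * (2 * (c + ε) * (n * √(n : ℝ))) ≤ ε * ∑ i, localField (W ω) σ i} with hU
  set D := {ω | IsLocalMinimum (W ω) σ ∧
    -ε * (2 * (c + -ε) * (n * √(n : ℝ))) ≤ -ε * ∑ i, localField (W ω) σ i} with hD
  rw [neg_sq] at hdown
  have hq0 : 0 < n * √(n : ℝ) := mul_pos (by linarith) (Real.sqrt_pos.2 (by linarith))
  have hq : (n : ℝ) ^ (-(3 / 2) : ℝ) = (n * √(n : ℝ))⁻¹ := by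
    rw [Real.rpow_neg (by linarith), show (3 / 2 : ℝ) = 1 + 1 / 2 by norm_num,
      Real.rpow_add (by linarith), Real.rpow_one, ← Real.sqrt_eq_rpow]
  -- Since `H` is minus half the sum of the fields, too low an energy falls in `U` (tilt `ε`) and
  -- too high an energy in `D` (tilt `-ε`).
  have hcover : A ⊆ (A ∩ B) ∪ (U ∪ D) := by
    intro ω hω
    by_cases hωB : ω ∈ B
    · exact Or.inl ⟨hω, hωB⟩
    right
    rw [hB, Set.mem_ofPred_eq, hq, hamiltonian_eq_sum_localField (hW.symm ω) (hW.diag ω),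
      not_and_or, not_le, not_le, inv_mul_lt_iff₀ hq0, lt_inv_mul_iff₀ hq0] at hωB
    rcases hωB with hωB | hωB
    · exact Or.inl ⟨hω, mul_le_mul_of_nonneg_left (by linarith) hε.le⟩
    · exact Or.inr ⟨hω, mul_le_mul_of_nonpos_left (by linarith) (by linarith)⟩
  have hAm : MeasurableSet A := measurableSet_isLocalMinimum hW σ
  have hsum : P.real A ≤ P.real (A ∩ B) + (P.real U + P.real D) :=
    (measureReal_mono hcover).trans ((measureReal_union_le _ _).trans
      (add_le_add_right (measureReal_union_le _ _) _))
  have hA0 : 0 < P.real A := (Real.exp_pos _).trans_le hlow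
  have hcond : (P[|A]).real B = (P.real A)⁻¹ * P.real (A ∩ B) := by
    rw [measureReal_def, cond_apply hAm, ENNReal.toReal_mul, ENNReal.toReal_inv]
    rfl
  rw [hcond, ← div_eq_inv_mul, le_div_iff₀ hA0]
  have h2 : (2 : ℝ) ≤ Real.exp 1 := by linarith [Real.add_one_le_exp (1 : ℝ)]
  have hs1 : 1 ≤ √(n : ℝ) := Real.one_le_sqrt.2 (by linarith)
  -- The tails contribute `24`, the factor `2 ≤ e` one more, and the lower bound `√n + 2`; since `√n
  -- ≥ 1`, the total is at most `28√n`.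
  have hkey : P.real U + P.real D ≤ Real.exp (28 * √(n : ℝ) - ε ^ 2 * n) * P.real A := by
    calc P.real U + P.real D ≤ 2 * Real.exp (n * κ - ε ^ 2 * n + 24) := by linarith
      _ ≤ Real.exp 1 * Real.exp (n * κ - ε ^ 2 * n + 24) :=
          mul_le_mul_of_nonneg_right h2 (Real.exp_nonneg _)
      _ ≤ Real.exp (28 * √(n : ℝ) - ε ^ 2 * n) * Real.exp (n * κ - √(n : ℝ) - 2) := by
          rw [← Real.exp_add, ← Real.exp_add]
          exact Real.exp_le_exp.2 (by linarith)
      _ ≤ _ := mul_le_mul_of_nonneg_left hlow (Real.exp_nonneg _)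
  linarith

end Concentration

end SK

theorem theorem1 :
    -- the supremum that defines `μ*` is finite
    (∀ x : ℝ, √(2 / Real.pi) ≤ x → BddAbove (SK.legendreValues x)) ∧
    -- `v` is the unique maximizer of `R` on `[√(2/π), ∞)`, and `α` is the maximum
    ∃ v α : ℝ, √(2 / Real.pi) < v ∧ α = SK.R v ∧ 0 < α ∧
      (∀ x : ℝ, √(2 / Real.pi) ≤ x → x ≠ v → SK.R x < α) ∧
      -- the exponential rate of the probability of local optimality
      (∀ (Ω : ℕ → Type*) [∀ n, MeasurableSpace (Ω n)] (P : ∀ n, Measure (Ω n))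
        [∀ n, IsProbabilityMeasure (P n)] (W : ∀ n, Ω n → Matrix (Fin n) (Fin n) ℝ),
        (∀ n, SK.IsDisorder (P n) (W n)) → ∀ σ : ∀ n, SK.Config n,
          Tendsto (fun n : ℕ =>
              (1 / (n : ℝ)) * Real.log ((P n).real {ω | SK.IsLocalMinimum (W n ω) (σ n)}))
            atTop (𝓝 (α - Real.log 2))) ∧
      -- concentration of the energy, conditionally on local optimality
      (∃ ε₀ > (0 : ℝ), ∃ L > (0 : ℝ), ∃ n₀ : ℕ, ∀ ε : ℝ, 0 < ε → ε < ε₀ → ∀ n : ℕ, n₀ ≤ n →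
        ∀ (Ω : Type*) [MeasurableSpace Ω] (P : Measure Ω) [IsProbabilityMeasure P]
          (W : Ω → Matrix (Fin n) (Fin n) ℝ), SK.IsDisorder P W → ∀ σ : SK.Config n,
          1 - Real.exp (L * √(n : ℝ) - ε ^ 2 * n) ≤
            (P[|{ω | SK.IsLocalMinimum (W ω) σ}]).real
              {ω | -(v / 2) - ε ≤ (n : ℝ) ^ (-(3 / 2) : ℝ) * SK.hamiltonian (W ω) σ ∧
                (n : ℝ) ^ (-(3 / 2) : ℝ) * SK.hamiltonian (W ω) σ ≤ -(v / 2) + ε}) := by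
  refine ⟨fun x _ => SK.bddAbove_legendreValues x, ?_⟩
  obtain ⟨c, hc0, hc1, h⟩ := SK.exists_critical_point
  have hc : 0 < c := lt_of_le_of_lt (by positivity) hc0
  have hα : SK.R (2 * c) - Real.log 2 =
      Real.log (cdf (gaussianReal 0 1) c) - c ^ 2 / 2 := by
    rw [SK.R_two_mul hc h, SK.phi_eq]
    ring
  have hsqrt : √(2 / Real.pi) = 2 * (√(2 * Real.pi))⁻¹ := by
    rw [Real.sqrt_eq_iff_mul_self_eq (by positivity) (by positivity), mul_mul_mul_comm, ← mul_inv,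
      Real.mul_self_sqrt (by positivity)]
    field_simp
  -- The tail bound needs `|s| < c`, whence `ε₀ = c`; `n₀ = 3` keeps `√(n-2)` positive.
  refine ⟨2 * c, SK.R (2 * c), by linarith, rfl, SK.R_two_mul_pos hc h,
    fun x hx hne => SK.R_lt_of_ne hc h ((Real.sqrt_nonneg _).trans hx) hne, ?_,
    c, hc, 28, by norm_num, 3, ?_⟩
  · intro Ω _ P _ W hW σ
    rw [hα]
    exact SK.tendsto_log_measureReal_isLocalMinimum hc hc1 h Ω P W hW σ
  · intro ε hε hεc n hn Ω _ P _ W hW σ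
    rw [mul_div_cancel_left₀ c two_ne_zero]
    exact SK.one_sub_exp_le_cond hc hc1 h hn hW σ hε hεc
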